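/- Let $n$ be a natural number. For $\sigma\in\mathbb R$ and $p\ge 1$ let $H^{\sigma}_p(\mathbb R^n)$ be the Bessel potential space, i.e. the space of tempered distributions $u$ with $J_\sigma u:=\mathcal F^{-1}\big((1+|\xi|^2)^{\sigma/2}\mathcal F u\big)\in L_p(\mathbb R^n)$, normed by $\|u\|_{H^\sigma_p}=\|J_\sigma u\|_{L_p}$. Let $H^{\sigma}_{p,loc}(\mathbb R^n)$ be the set of distributions $u\in D'(\mathbb R^n)$ with $f\cdot u\in H^\sigma_p(\mathbb R^n)$ for all $f\in D(\mathbb R^n)=C_c^\infty(\mathbb R^n)$. Let $H^{\sigma}_{p,unif}(\mathbb R^n)$ be the set of $u\in H^\sigma_{p,loc}(\mathbb R^n)$ with $\sup_{z\in\mathbb R^n}\|\eta(\cdot-z)\,u\|_{H^\sigma_p}<\infty$, where $\eta\in D(\mathbb R^n)$ is any fixed function with $0\le\eta\le1$, $\eta(x)=1$ for $|x|\le1$ and $\eta(x)=0$ for $|x|\ge2$. For $s,t\ge0$ let $M[s,-t]$ be the set of $\mu\in H^{-t}_{2,loc}(\mathbb R^n)$ for which there is $C>0$ such that $\|f\cdot\mu\|_{H^{-t}_2}\le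 C\|f\|_{H^s_2}$ for all $f\in D(\mathbb R^n)$ (the multipliers from $H^s_2(\mathbb R^n)$ to $H^{-t}_2(\mathbb R^n)$). **Theorem.** Let $s,t\ge0$ with $0<\max(s,t)<\frac n2$, and let $0<\varepsilon<\frac{n}{\max(s,t)}-2$. Then there is $\delta=\delta(\varepsilon)\in\big(0,\frac n2-\max(s,t)\big)$ such that, for $\alpha=s+t+\delta$, the function $f_\alpha(x)=|x|^{-\alpha}$ for $x\ne0$, $f_\alpha(0)=0$, is locally integrable, and the distribution $\varphi\mapsto\int_{\mathbb R^n} f_\alpha\varphi\,dx$ that it generates belongs, for every admissible choice of $\eta$, to $$H^{-\min(s,t)}_{\frac{n}{\max(s,t)}-\varepsilon,\;unif}(\mathbb R^n)\setminus M[s,-t].$$ In particular, for every such $\varepsilon$ and every admissible $\eta$, $H^{-\min(s,t)}_{p_1-\varepsilon,\,unif}(\mathbb R^n)\not\subset M[s,-t]$, where $p_1=\frac{n}{\max(s,t)}$; that is, the exponent $p_1$ cannot be lowered in the embedding $H^{-\min(s,t)}_{p_1,\,unif}(\mathbb R^n)\subset M[s,-t]$. -/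

import Mathlib

noncomputable section

open MeasureTheory TopologicalSpace
open scoped ENNReal Distributions SchwartzMap

namespace BesselMult

/-- The Euclidean space of dimension `n`. -/
abbrev Eucl (n : ℕ) : Type := EuclideanSpace ℝ (Fin n)

/-- Complex-valued smooth compactly supported functions on the whole space, with their usual
(LF-space) topology. -/
abbrev Test (n : ℕ) : Type := 𝓓((⊤ : Opens (Eucl n)), ℂ)

/-- Distributions on the whole space: continuous linear functionals on the test functions. -/
abbrev Dist (n : ℕ) : Type := Test n →L[ℂ] ℂ

variable {n : ℕ}

/-- The pointwise product of two test functions. -/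
def mulTest (f φ : Test n) : Test n where
  toFun x := f x * φ x
  contDiff' := f.contDiff.mul φ.contDiff
  hasCompactSupport' := φ.hasCompactSupport.mul_left
  tsupport_subset' := by simp

/-- Multiplication by a test function is continuous on the space of test functions. -/
def mulTestCLM (f : Test n) : Test n →L[ℂ] Test n :=
  TestFunction.limitCLM ℂ (mulTest f)
    (fun _ hK => (TestFunction.ofSupportedInCLM ℂ hK).comp
      (ContDiffMapSupportedIn.bilinLeftCLM (ContinuousLinearMap.mul ℂ ℂ) f.contDiff))
    (by
      intro K hK φ
      ext x
      simp [mulTest, mul_comm])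

/-- The product `f · u` of a test function and a distribution: `(f · u)(φ) = u (f φ)`. -/
def mulDist (f : Test n) (u : Dist n) : Dist n := u.comp (mulTestCLM f)

/-- A test function, viewed as a Schwartz function. -/
def toSchwartz (φ : Test n) : 𝓢(Eucl n, ℂ) := φ.hasCompactSupport.toSchwartzMap φ.contDiff

theorem continuous_toSchwartz_ofSupportedIn (K : Compacts (Eucl n))
    (hK : (K : Set (Eucl n)) ⊆ (⊤ : Opens (Eucl n))) :
    Continuous ((toSchwartz (n := n)) ∘ TestFunction.ofSupportedIn (F := ℂ) (n := ⊤) hK) := by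
  let Φ : 𝓓_{K}(Eucl n, ℂ) →ₗ[ℂ] 𝓢(Eucl n, ℂ) :=
    { toFun := fun f => toSchwartz (TestFunction.ofSupportedIn hK f)
      map_add' := fun _ _ => rfl
      map_smul' := fun _ _ => rfl }
  change Continuous Φ
  obtain ⟨R, hR⟩ := K.isCompact.isBounded.exists_norm_le
  refine WithSeminorms.continuous_of_isBounded
    (ContDiffMapSupportedIn.withSeminorms ℂ (Eucl n) ℂ ⊤ K)
    (schwartz_withSeminorms ℂ (Eucl n) ℂ) Φ fun q => ?_
  refine ⟨{q.2}, ⟨(max R 0) ^ q.1, pow_nonneg (le_max_right _ _) _⟩, fun f => ?_⟩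
  refine (Φ f).seminorm_le_bound ℂ q.1 q.2
    (mul_nonneg (NNReal.coe_nonneg _) (apply_nonneg _ _)) fun x => ?_
  simp only [Finset.sup_singleton]
  change ‖x‖ ^ q.1 * ‖iteratedFDeriv ℝ q.2 (f : Eucl n → ℂ) x‖ ≤
    (max R 0) ^ q.1 * ContDiffMapSupportedIn.seminorm ℂ (Eucl n) ℂ ⊤ K q.2 f
  by_cases hx : x ∈ K
  · exact mul_le_mul (pow_le_pow_left₀ (norm_nonneg x) ((hR x hx).trans (le_max_left _ _)) _)
      (ContDiffMapSupportedIn.norm_iteratedFDeriv_apply_le_seminorm_top ℂ)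
      (norm_nonneg _) (by positivity)
  · have h0 : iteratedFDeriv ℝ q.2 (f : Eucl n → ℂ) x = 0 := f.iteratedFDeriv_zero_on_compl hx
    rw [h0, norm_zero, mul_zero]
    exact mul_nonneg (by positivity) (apply_nonneg _ _)

/-- The inclusion of the test functions into the Schwartz space, as a continuous linear map. -/
def toSchwartzCLM (n : ℕ) : Test n →L[ℂ] 𝓢(Eucl n, ℂ) :=
  TestFunction.mkCLM ℂ toSchwartz (fun _ _ => rfl) (fun _ _ => rfl)
    (fun K hK => continuous_toSchwartz_ofSupportedIn K hK)

/-- The distribution defined by a tempered distribution, by restriction to test functions. -/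
def toDist (v : 𝓢'(Eucl n, ℂ)) : Dist n :=
  { toLinearMap := v.toLinearMap ∘ₗ (toSchwartzCLM n).toLinearMap
    cont := v.cont.comp (toSchwartzCLM n).cont }

/-- The regular distribution `φ ↦ ∫ φ g` generated by a locally integrable function `g`
(and the zero distribution if `g` is not locally integrable). -/
def regular (g : Eucl n → ℂ) : Dist n :=
  TestFunction.integralAgainstBilinCLM (ContinuousLinearMap.mul ℂ ℂ) volume g

/-- A distribution belongs to the Bessel potential space of order `s` and exponent `p ≥ 1` if it
is (the restriction of) a tempered distribution whose Bessel potential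
`𝓕⁻¹ ((1 + ‖x‖ ^ 2) ^ (s / 2) 𝓕 v)` is a function in `L^p`. -/
def MemBessel (s : ℝ) (p : ℝ≥0∞) (u : Dist n) : Prop :=
  ∃ v : 𝓢'(Eucl n, ℂ), toDist v = u ∧
    ∃ _ : Fact (1 ≤ p), TemperedDistribution.MemSobolev s p v

/-- The norm of the Bessel potential space of order `s` and exponent `p ≥ 1`: the `L^p` norm of
the Bessel potential, and `∞` for a distribution that is not in the space. (The tempered
distribution `v` and the function `g` are unique if they exist.) -/
def besselNorm (s : ℝ) (p : ℝ≥0∞) (u : Dist n) : ℝ≥0∞ :=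
  ⨅ (v : 𝓢'(Eucl n, ℂ)) (_ : toDist v = u) (_ : Fact (1 ≤ p))
    (g : Lp ℂ p (volume : Measure (Eucl n)))
    (_ : TemperedDistribution.besselPotential (Eucl n) ℂ s v = (g : 𝓢'(Eucl n, ℂ))), ‖g‖ₑ

/-- Distributions that are locally in the Bessel potential space. -/
def besselLoc (n : ℕ) (s : ℝ) (p : ℝ≥0∞) : Set (Dist n) :=
  {u | ∀ f : Test n, MemBessel s p (mulDist f u)}

/-- Admissible cutoff functions: `0 ≤ η ≤ 1`, `η = 1` on the closed unit ball and `η = 0` outside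
the open ball of radius two. -/
def IsCutoff (η : Test n) : Prop :=
  (∀ x, ∃ r ∈ Set.Icc (0 : ℝ) 1, η x = (r : ℂ)) ∧
    (∀ x, ‖x‖ ≤ 1 → η x = 1) ∧ (∀ x, 2 ≤ ‖x‖ → η x = 0)

/-- The translate `x ↦ η (x - z)` of a test function. -/
def translate (z : Eucl n) (η : Test n) : Test n where
  toFun x := η (x - z)
  contDiff' := η.contDiff.comp (contDiff_id.sub contDiff_const)
  hasCompactSupport' := by
    simpa [sub_eq_add_neg, Function.comp_def] using
      η.hasCompactSupport.comp_homeomorph (Homeomorph.addRight (-z))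
  tsupport_subset' := by simp

/-- The uniformly localized Bessel potential space of order `s` and exponent `p`, formed with the
cutoff function `η`. -/
def besselUnif (s : ℝ) (p : ℝ≥0∞) (η : Test n) : Set (Dist n) :=
  {u | u ∈ besselLoc n s p ∧ ⨆ z : Eucl n, besselNorm s p (mulDist (translate z η) u) < ⊤}

/-- The multipliers from the Bessel potential space of order `s` and exponent `p` to the Bessel
potential space of order `-t` and exponent `r`. -/
def multipliers (n : ℕ) (s : ℝ) (p : ℝ≥0∞) (t : ℝ) (r : ℝ≥0∞) : Set (Dist n) :=
  {μ | μ ∈ besselLoc n (-t) r ∧ ∃ C : ℝ, 0 < C ∧ ∀ f : Test n,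
    besselNorm (-t) r (mulDist f μ) ≤ ENNReal.ofReal C * besselNorm s p (regular (f : Eucl n → ℂ))}

/-- The space `M[s, -t]` of multipliers between the `L²`-based spaces of orders `s` and `-t`. -/
def M (n : ℕ) (s t : ℝ) : Set (Dist n) := multipliers n s 2 t 2

open Classical in
/-- The function equal to `|x| ^ (-α)` for `x ≠ 0` and to `0` at the origin. -/
def powerFun (n : ℕ) (α : ℝ) (x : Eucl n) : ℂ :=
  if x = 0 then 0 else ((‖x‖ ^ (-α) : ℝ) : ℂ)

end BesselMult

end

noncomputable section

open MeasureTheory TopologicalSpace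
open scoped ENNReal Distributions SchwartzMap

namespace BesselMult

variable {n : ℕ}

open Real Set FourierTransform TemperedDistribution Filter Topology

/-! Write `a = max s t`, `b = min s t`, `p = n / a - ε`, `α = a + b + δ`. Lowering the exponent
below `n / a` leaves a gap `n / p - a > 0`; taking `δ` to be half of it makes `|x|^(-α)` slightly
too singular to be a multiplier, yet mild enough for the space with exponent `p`.

Membership: `|x|^(-α)` is locally in `L^q` when `α q < n`, and is at most 1 outside the unit ball,
so its products with the translates of a cutoff are bounded in `L^q` uniformly. For `b > 0`, `L^q`
embeds into the space of order `-b` and exponent `p` as soon as `0 ≤ 1/q - 1/p < b/n`: the potential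
of order `-b` is convolution with the Bessel kernel, a Gamma-weighted superposition of Gaussians,
which lies in a suitable `L^r`, and Young's inequality applies (`exists_besselPotential_neg_le`).
The strict inequality suffices because of the gap (`exists_lebesgue_exponent`).

Non-membership: let `f` be the dilate `χ(x / l)` of a cutoff, `l ≤ 1`. Pairing `f · |x|^(-α)` with
`f` gives `c l^(n - α)` with `c ≠ 0`, while a multiplier bound and duality allow at most a constant
times `l^(n/2 - s) l^(n/2 - t) = l^(n - α) l^δ`. Letting `l → 0` is a contradiction
(`regular_powerFun_notMem_M`). -/

/-! ### Gaussian and Bessel kernels: pointwise bounds -/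

/-- The Gauss-Weierstrass kernel: the inverse Fourier transform of `ξ ↦ exp (-τ ‖ξ‖ ^ 2)`. -/
def heatKernel (τ : ℝ) (x : Eucl n) : ℝ :=
  (π / τ) ^ ((n : ℝ) / 2) * exp (-(π ^ 2 / τ) * ‖x‖ ^ 2)

theorem heatKernel_nonneg {τ : ℝ} (hτ : 0 < τ) (x : Eucl n) : 0 ≤ heatKernel τ x := by
  unfold heatKernel; positivity

theorem heatKernel_neg (τ : ℝ) (x : Eucl n) : heatKernel τ (-x) = heatKernel τ x := by
  simp [heatKernel]

theorem measurable_heatKernel : Measurable fun z : ℝ × Eucl n => heatKernel z.1 z.2 := by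
  unfold heatKernel; fun_prop

theorem integrable_heatKernel {τ : ℝ} (hτ : 0 < τ) :
    Integrable (heatKernel τ : Eucl n → ℝ) := by
  have h : 0 < π ^ 2 / τ := by positivity
  have := (GaussianFourier.integrable_cexp_neg_mul_sq_norm_add (V := Eucl n)
    (b := ((π ^ 2 / τ : ℝ) : ℂ)) (by rw [Complex.ofReal_re]; exact h) 0 0).re
  refine (this.congr (ae_of_all _ fun x => ?_)).const_mul _
  have : (-((π ^ 2 / τ : ℝ) : ℂ) * (‖x‖ : ℂ) ^ 2 + 0 * (inner ℝ (0 : Eucl n) x : ℝ)) =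
    ((-(π ^ 2 / τ) * ‖x‖ ^ 2 : ℝ) : ℂ) := by push_cast; ring
  beta_reduce
  rw [this, ← Complex.ofReal_exp]
  exact Complex.ofReal_re _

theorem integral_heatKernel {τ : ℝ} (hτ : 0 < τ) :
    ∫ x : Eucl n, heatKernel τ x = 1 := by
  have h : 0 < π ^ 2 / τ := by positivity
  unfold heatKernel
  rw [integral_const_mul, GaussianFourier.integral_rexp_neg_mul_sq_norm h,
    finrank_euclideanSpace_fin, ← mul_rpow (by positivity) (by positivity)]
  have : π / τ * (π / (π ^ 2 / τ)) = 1 := by field_simp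
  rw [this, one_rpow]

/-- The Bessel kernel of order `b`: the inverse Fourier transform of
`ξ ↦ (1 + ‖ξ‖ ^ 2) ^ (-b / 2)`. -/
def besselKernel (b : ℝ) (x : Eucl n) : ℝ :=
  (Gamma (b / 2))⁻¹ * ∫ τ in Ioi (0 : ℝ), τ ^ (b / 2 - 1) * exp (-τ) * heatKernel τ x

theorem besselKernel_nonneg {b : ℝ} (hb : 0 < b) (x : Eucl n) : 0 ≤ besselKernel b x := by
  refine mul_nonneg (inv_nonneg.2 (Gamma_pos_of_pos (by positivity)).le) ?_
  refine setIntegral_nonneg measurableSet_Ioi fun τ hτ => ?_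
  have := heatKernel_nonneg hτ x
  have h : (0 : ℝ) < τ := hτ
  positivity

theorem besselKernel_neg (b : ℝ) (x : Eucl n) : besselKernel b (-x) = besselKernel b x := by
  simp [besselKernel, heatKernel_neg]

theorem measurable_besselKernel (b : ℝ) : Measurable (besselKernel b : Eucl n → ℝ) := by
  unfold besselKernel
  refine Measurable.const_mul ?_ _
  have : StronglyMeasurable fun z : Eucl n × ℝ =>
      z.2 ^ (b / 2 - 1) * exp (-z.2) * heatKernel z.2 z.1 := by
    refine Measurable.stronglyMeasurable ?_
    have := (measurable_heatKernel (n := n)).comp measurable_swap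
    refine Measurable.mul ?_ this
    fun_prop
  exact this.integral_prod_right'.measurable

theorem integrableOn_gamma_weight {a : ℝ} (ha : 0 < a) :
    IntegrableOn (fun τ : ℝ => τ ^ (a - 1) * exp (-τ)) (Ioi 0) := by
  simpa [mul_comm] using GammaIntegral_convergent ha

theorem rpow_le_mul_exp {θ u : ℝ} (hθ : 0 < θ) (hu : 0 ≤ u) : u ^ θ ≤ θ ^ θ * exp u := by
  have h1 : u / θ ≤ exp (u / θ) := by linarith [add_one_le_exp (u / θ)]
  have h2 := rpow_le_rpow (by positivity) h1 hθ.le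
  rw [div_rpow hu hθ.le, ← exp_mul, div_mul_cancel₀ _ hθ.ne', div_le_iff₀ (by positivity)] at h2
  linarith

/-- Gaussian decay is traded for a power of `‖x‖`. The exponent `θ` stays free, since the
singularity at the origin and the decay at infinity require different values. -/
theorem exists_heatKernel_le {θ : ℝ} (hθ : 0 < θ) : ∃ C : ℝ, 0 ≤ C ∧
    ∀ (τ : ℝ) (x : Eucl n), 0 < τ → x ≠ 0 →
      heatKernel τ x ≤ C * τ ^ (θ - (n : ℝ) / 2) * ‖x‖ ^ (-(2 * θ)) := by
  refine ⟨π ^ ((n : ℝ) / 2) * θ ^ θ * (π ^ 2) ^ (-θ), by positivity, fun τ x hτ hx => ?_⟩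
  have hx' : 0 < ‖x‖ := norm_pos_iff.2 hx
  set u := π ^ 2 / τ * ‖x‖ ^ 2 with hu
  have hu0 : 0 < u := by positivity
  have h := rpow_le_mul_exp hθ hu0.le
  have h1 : exp (-u) ≤ θ ^ θ * u ^ (-θ) := by
    rw [exp_neg, rpow_neg hu0.le, ← div_eq_mul_inv, inv_eq_one_div,
      div_le_div_iff₀ (exp_pos _) (by positivity)]
    linarith
  have h2 : u ^ (-θ) = (π ^ 2) ^ (-θ) * τ ^ θ * ‖x‖ ^ (-(2 * θ)) := by
    rw [hu, mul_rpow (by positivity) (by positivity), div_rpow (by positivity) hτ.le,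
      rpow_neg hτ.le, div_inv_eq_mul, ← rpow_natCast ‖x‖ 2, ← rpow_mul hx'.le]
    norm_num
  calc heatKernel τ x = (π / τ) ^ ((n : ℝ) / 2) * exp (-u) := by
        rw [heatKernel, hu]; ring_nf
    _ ≤ (π / τ) ^ ((n : ℝ) / 2) * (θ ^ θ * u ^ (-θ)) := by gcongr
    _ = _ := by
        rw [h2, div_rpow pi_pos.le hτ.le, rpow_sub hτ]; field_simp

/-- After the heat kernel bound, a Gamma integral with parameter `b / 2 + θ - n / 2` remains; the
hypothesis `n - b < 2θ` is its convergence at `τ = 0`. -/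
theorem exists_besselKernel_le {b θ : ℝ} (hb : 0 < b) (hθ : 0 < θ) (hθb : (n : ℝ) - b < 2 * θ) :
    ∃ C : ℝ, 0 ≤ C ∧ ∀ x : Eucl n, x ≠ 0 → besselKernel b x ≤ C * ‖x‖ ^ (-(2 * θ)) := by
  obtain ⟨C, hC, h⟩ := exists_heatKernel_le (n := n) hθ
  have hG : 0 < Gamma (b / 2) := Gamma_pos_of_pos (by positivity)
  refine ⟨(Gamma (b / 2))⁻¹ * (C * Gamma (b / 2 + θ - n / 2)), ?_, fun x hx => ?_⟩
  · have := Gamma_pos_of_pos (show 0 < b / 2 + θ - n / 2 by linarith)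
    positivity
  unfold besselKernel
  rw [mul_assoc]
  gcongr
  have key : ∀ τ ∈ Ioi (0 : ℝ), τ ^ (b / 2 - 1) * exp (-τ) * heatKernel τ x ≤
      (C * ‖x‖ ^ (-(2 * θ))) * (exp (-τ) * τ ^ ((b / 2 + θ - n / 2) - 1)) := by
    intro τ hτ
    have hτ' : (0 : ℝ) < τ := hτ
    have e : τ ^ ((b / 2 + θ - n / 2) - 1) = τ ^ (b / 2 - 1) * τ ^ (θ - (n : ℝ) / 2) := by
      rw [← rpow_add hτ']; congr 1; ring
    calc _ ≤ τ ^ (b / 2 - 1) * exp (-τ) * (C * τ ^ (θ - (n : ℝ) / 2) * ‖x‖ ^ (-(2 * θ))) := by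
          gcongr; exact h τ x hτ' hx
      _ = _ := by rw [e]; ring
  calc _ ≤ ∫ τ in Ioi (0 : ℝ),
        (C * ‖x‖ ^ (-(2 * θ))) * (exp (-τ) * τ ^ ((b / 2 + θ - n / 2) - 1)) := by
        refine integral_mono_of_nonneg ?_ ?_ ?_
        · filter_upwards [ae_restrict_mem measurableSet_Ioi] with τ hτ
          have hτ' : (0 : ℝ) < τ := hτ
          have := heatKernel_nonneg hτ x
          simp only [Pi.zero_apply]; positivity
        · exact (GammaIntegral_convergent (by linarith)).const_mul _
        · filter_upwards [ae_restrict_mem measurableSet_Ioi] with τ hτ using key τ hτ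
    _ = _ := by
        rw [integral_const_mul, ← Gamma_eq_integral (by linarith)]; ring

/-! ### The Bessel potential as a convolution -/

theorem one_add_norm_sq_rpow_eq_integral {b : ℝ} (hb : 0 < b) (ξ : Eucl n) :
    (1 + ‖ξ‖ ^ 2) ^ (-b / 2) = (Gamma (b / 2))⁻¹ *
      ∫ τ in Ioi (0 : ℝ), τ ^ (b / 2 - 1) * exp (-τ) * exp (-τ * ‖ξ‖ ^ 2) := by
  have hG : 0 < Gamma (b / 2) := Gamma_pos_of_pos (by positivity)
  have h := integral_rpow_mul_exp_neg_mul_Ioi (a := b / 2) (r := 1 + ‖ξ‖ ^ 2) (by positivity)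
    (by positivity)
  have e : ∀ τ : ℝ, τ ^ (b / 2 - 1) * exp (-τ) * exp (-τ * ‖ξ‖ ^ 2) =
      τ ^ (b / 2 - 1) * exp (-((1 + ‖ξ‖ ^ 2) * τ)) := by
    intro τ
    rw [mul_assoc, ← exp_add]; ring_nf
  simp_rw [e, h]
  rw [neg_div, rpow_neg (by positivity), one_div, inv_rpow (by positivity)]
  field_simp

/-- The Fourier transform is moved from `u` to the modulated Gaussian, whose own transform is the
heat kernel centred at `x`. -/
theorem integral_fourier_mul_gaussian {τ : ℝ} (hτ : 0 < τ) (u : 𝓢(Eucl n, ℂ)) (x : Eucl n) :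
    ∫ ξ, 𝓕 u ξ * Complex.exp (-τ * ‖ξ‖ ^ 2 + 2 * π * Complex.I * (inner ℝ x ξ : ℝ)) =
      ∫ y, (heatKernel τ (x - y) : ℂ) * u y := by
  have hτ' : 0 < (τ : ℂ).re := by simpa using hτ
  have hint : Integrable fun ξ : Eucl n =>
      Complex.exp (-τ * ‖ξ‖ ^ 2 + 2 * π * Complex.I * (inner ℝ x ξ : ℝ)) :=
    GaussianFourier.integrable_cexp_neg_mul_sq_norm_add hτ' _ x
  have h := VectorFourier.integral_fourierIntegral_smul_eq_flip (L := innerₗ (Eucl n))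
    continuous_fourierChar continuous_inner (u.integrable (μ := volume)) hint
  simp only [smul_eq_mul, flip_innerₗ] at h
  refine Eq.trans ?_ (h.trans ?_)
  · rfl
  · refine integral_congr_ae (ae_of_all _ fun y => ?_)
    have h2 := fourier_gaussian_innerProductSpace' hτ' x y
    beta_reduce
    rw [mul_comm]
    congr 1
    refine Eq.trans h2 ?_
    rw [heatKernel, finrank_euclideanSpace_fin]
    push_cast
    rw [Complex.ofReal_cpow (by positivity)]
    push_cast
    congr 2
    ring

/-- Fubini is justified by the unit mass of the heat kernel, the integrability of the Gamma weight
and the boundedness of `u`. -/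
theorem integral_heatKernel_mul_swap {b : ℝ} (hb : 0 < b) (u : 𝓢(Eucl n, ℂ)) (x : Eucl n) :
    ∫ τ in Ioi (0 : ℝ), ((τ ^ (b / 2 - 1) * exp (-τ) : ℝ) : ℂ) *
      ∫ y, (heatKernel τ (x - y) : ℂ) * u y =
    ∫ y, ((∫ τ in Ioi (0 : ℝ), τ ^ (b / 2 - 1) * exp (-τ) * heatKernel τ (x - y) : ℝ) : ℂ) * u y
    := by
  set w : ℝ → ℝ := fun τ => τ ^ (b / 2 - 1) * exp (-τ) with hw
  have hwm : Measurable w := by rw [hw]; fun_prop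
  have hwi : IntegrableOn w (Ioi 0) := integrableOn_gamma_weight (by positivity)
  have hKm : Measurable fun z : ℝ × Eucl n => heatKernel z.1 (x - z.2) :=
    measurable_heatKernel.comp (measurable_fst.prodMk (measurable_const.sub measurable_snd))
  have hK : Integrable (fun z : ℝ × Eucl n => w z.1 * heatKernel z.1 (x - z.2))
      ((volume.restrict (Ioi 0)).prod volume) := by
    have hm : Measurable fun z : ℝ × Eucl n => w z.1 * heatKernel z.1 (x - z.2) :=
      (hwm.comp measurable_fst).mul hKm
    rw [integrable_prod_iff hm.aestronglyMeasurable]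
    constructor
    · filter_upwards [ae_restrict_mem measurableSet_Ioi] with τ hτ
      exact ((integrable_heatKernel hτ).comp_sub_left x).const_mul _
    · refine hwi.congr ?_
      filter_upwards [ae_restrict_mem measurableSet_Ioi] with τ hτ
      have hτ' : (0 : ℝ) < τ := hτ
      have h0 : 0 ≤ w τ := by rw [hw]; positivity
      have : ∀ y : Eucl n, ‖w τ * heatKernel τ (x - y)‖ = w τ * heatKernel τ (x - y) := fun y =>
        norm_of_nonneg (mul_nonneg h0 (heatKernel_nonneg hτ _))
      simp_rw [this]
      rw [integral_const_mul, integral_sub_left_eq_self (heatKernel τ) volume x,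
        integral_heatKernel hτ, mul_one]
  obtain ⟨M, hM⟩ : ∃ M, ∀ y, ‖u y‖ ≤ M :=
    ⟨_, fun y => u.toBoundedContinuousFunction.norm_coe_le_norm y⟩
  have hF : Integrable (fun z : ℝ × Eucl n => (w z.1 : ℂ) * ((heatKernel z.1 (x - z.2) : ℂ) * u z.2))
      ((volume.restrict (Ioi 0)).prod volume) := by
    refine (hK.norm.mul_const M).mono' ?_ (ae_of_all _ fun z => ?_)
    · refine Measurable.aestronglyMeasurable ?_
      have := u.continuous.measurable
      fun_prop
    · simp only [norm_mul, Complex.norm_real, ← mul_assoc]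
      gcongr
      exact hM _
  simp_rw [← integral_const_mul]
  rw [integral_integral_swap hF]
  refine integral_congr_ae (ae_of_all _ fun y => ?_)
  beta_reduce
  rw [← integral_complex_ofReal, ← integral_mul_const]
  simp [mul_assoc]

/-- The Gaussian identity is integrated against the Gamma weight in `τ`. On the frequency side the
integrand is dominated by `‖𝓕 u ξ‖ * ‖w τ‖`, which allows the exchange. -/
theorem integral_fourier_mul_one_add_norm_sq_rpow {b : ℝ} (hb : 0 < b) (u : 𝓢(Eucl n, ℂ))
    (x : Eucl n) :
    ∫ ξ, 𝓕 u ξ * (Complex.exp (2 * π * Complex.I * (inner ℝ x ξ : ℝ)) *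
      ((1 + ‖ξ‖ ^ 2) ^ (-b / 2) : ℝ)) = ∫ y, (besselKernel b (x - y) : ℂ) * u y := by
  set w : ℝ → ℝ := fun τ => τ ^ (b / 2 - 1) * exp (-τ) with hw
  have hwm : Measurable w := by rw [hw]; fun_prop
  have hwi : IntegrableOn w (Ioi 0) := integrableOn_gamma_weight (by positivity)
  have hF : Integrable (fun z : Eucl n × ℝ => (w z.2 : ℂ) *
      (𝓕 u z.1 * Complex.exp (-z.2 * ‖z.1‖ ^ 2 + 2 * π * Complex.I * (inner ℝ x z.1 : ℝ))))
      (volume.prod (volume.restrict (Ioi 0))) := by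
    refine ((𝓕 u).integrable.norm.mul_prod hwi.norm).mono' ?_ ?_
    · refine Measurable.aestronglyMeasurable ?_
      have := (𝓕 u).continuous.measurable
      have h2 : Measurable fun z : Eucl n × ℝ => inner ℝ x z.1 := by fun_prop
      fun_prop
    · have : ∀ᵐ z ∂((volume : Measure (Eucl n)).prod (volume.restrict (Ioi (0 : ℝ)))), 0 < z.2 :=
        Measure.quasiMeasurePreserving_snd.ae (ae_restrict_mem measurableSet_Ioi)
      filter_upwards [this] with z hz
      have h1 : ‖Complex.exp (-z.2 * ‖z.1‖ ^ 2 + 2 * π * Complex.I * (inner ℝ x z.1 : ℝ))‖ ≤ 1 := by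
        rw [Complex.norm_exp, exp_le_one_iff]
        simp [← Complex.ofReal_pow]
        positivity
      rw [norm_mul, norm_mul, Complex.norm_real, mul_comm]
      gcongr
      exact mul_le_of_le_one_right (norm_nonneg _) h1
  have e1 : ∀ ξ : Eucl n, 𝓕 u ξ * (Complex.exp (2 * π * Complex.I * (inner ℝ x ξ : ℝ)) *
      ((1 + ‖ξ‖ ^ 2) ^ (-b / 2) : ℝ)) = ((Gamma (b / 2))⁻¹ : ℝ) * ∫ τ in Ioi (0 : ℝ), (w τ : ℂ) *
      (𝓕 u ξ * Complex.exp (-τ * ‖ξ‖ ^ 2 + 2 * π * Complex.I * (inner ℝ x ξ : ℝ))) := by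
    intro ξ
    rw [one_add_norm_sq_rpow_eq_integral hb, Complex.ofReal_mul, ← integral_complex_ofReal]
    have : ∀ τ : ℝ, (w τ : ℂ) *
      (𝓕 u ξ * Complex.exp (-τ * ‖ξ‖ ^ 2 + 2 * π * Complex.I * (inner ℝ x ξ : ℝ))) =
      (𝓕 u ξ * Complex.exp (2 * π * Complex.I * (inner ℝ x ξ : ℝ))) *
        ((τ ^ (b / 2 - 1) * exp (-τ) * exp (-τ * ‖ξ‖ ^ 2) : ℝ) : ℂ) := by
      intro τ
      rw [Complex.exp_add, hw]
      push_cast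
      ring
    simp_rw [this]
    rw [integral_const_mul]
    ring
  simp_rw [e1]
  rw [integral_const_mul, integral_integral_swap hF]
  have e2 : ∀ τ ∈ Ioi (0 : ℝ), ∫ ξ, (w τ : ℂ) *
      (𝓕 u ξ * Complex.exp (-τ * ‖ξ‖ ^ 2 + 2 * π * Complex.I * (inner ℝ x ξ : ℝ))) =
      (w τ : ℂ) * ∫ y, (heatKernel τ (x - y) : ℂ) * u y := by
    intro τ hτ
    rw [integral_const_mul, integral_fourier_mul_gaussian hτ]
  rw [setIntegral_congr_fun measurableSet_Ioi e2, integral_heatKernel_mul_swap hb,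
    ← integral_const_mul]
  refine integral_congr_ae (ae_of_all _ fun y => ?_)
  simp only [besselKernel]
  push_cast
  ring

/-- On Schwartz functions, the Bessel potential of negative order is the convolution with the
Bessel kernel. -/
theorem fourier_smulLeft_fourierInv_eq_integral {b : ℝ} (hb : 0 < b) (u : 𝓢(Eucl n, ℂ))
    (x : Eucl n) :
    𝓕 (SchwartzMap.smulLeftCLM ℂ (fun ξ : Eucl n => (((1 + ‖ξ‖ ^ 2) ^ (-b / 2) : ℝ) : ℂ))
      (𝓕⁻ u)) x = ∫ y, (besselKernel b (x - y) : ℂ) * u y := by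
  -- The reflection `ξ ↦ -ξ` turns `𝓕⁻ u` into `𝓕 u` and the forward phase into the inverse one; the
  -- weight is even.
  rw [← integral_fourier_mul_one_add_norm_sq_rpow hb, SchwartzMap.fourier_coe, Real.fourier_eq',
    ← integral_neg_eq_self]
  refine integral_congr_ae (ae_of_all _ fun ξ => ?_)
  beta_reduce
  rw [SchwartzMap.smulLeftCLM_apply_apply (by fun_prop)]
  have : (𝓕⁻ u) (-ξ) = 𝓕 u ξ := by
    rw [SchwartzMap.fourierInv_coe, SchwartzMap.fourier_coe, Real.fourierInv_eq_fourier_neg,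
      neg_neg]
  rw [this, inner_neg_left, real_inner_comm]
  simp only [norm_neg, smul_eq_mul]
  push_cast
  ring_nf

/-! ### Embedding of `L^q` by Young's inequality -/

theorem lintegral_besselKernel_rpow_lt_top {b r : ℝ} (hn : 0 < n) (hb : 0 < b) (hr : 1 ≤ r)
    (h : ((n : ℝ) - b) * r < n) :
    ∫⁻ x : Eucl n, ENNReal.ofReal (besselKernel b x) ^ r < ∞ := by
  have hn' : (0 : ℝ) < n := by exact_mod_cast hn
  have hr0 : 0 < r := by linarith
  have hnr : max ((n : ℝ) - b) 0 < n / r := by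
    rw [max_lt_iff, lt_div_iff₀ hr0]
    exact ⟨h, by positivity⟩
  -- The exponent `c` exceeds `n - b` and 0, so that the kernel is `O(‖x‖^(-c))`, and satisfies `c *
  -- r < n`, so that its `r`-th power is integrable on the unit ball. The second bound, with `θ =
  -- n`, gives the decay `‖x‖^(-2n)` used outside.
  obtain ⟨c, hc1, hc2⟩ := exists_between hnr
  rw [max_lt_iff] at hc1
  obtain ⟨C₁, hC₁, h₁⟩ := exists_besselKernel_le (n := n) (θ := c / 2) hb (by linarith)
    (by linarith)
  obtain ⟨C₂, hC₂, h₂⟩ := exists_besselKernel_le (n := n) (θ := n) hb hn' (by linarith)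
  have hm : AEStronglyMeasurable (fun x : Eucl n => besselKernel b x ^ r) :=
    ((measurable_besselKernel b).pow_const r).aestronglyMeasurable
  have hne : ∀ᵐ x : Eucl n, x ≠ 0 := by
    have : Nonempty (Fin n) := ⟨⟨0, hn⟩⟩
    exact compl_mem_ae_iff.2 (measure_singleton _)
  have hball : IntegrableOn (fun x : Eucl n => besselKernel b x ^ r) (Metric.ball 0 1) := by
    refine integrableOn_ball_of_norm_le_rpow (C := C₁ ^ r) (α := c * r) (by simpa using Nat.succ_le_of_lt hn) ?_
      (ae_restrict_of_ae ?_) hm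
    · rw [finrank_euclideanSpace_fin]; exact (lt_div_iff₀ hr0).1 hc2
    · filter_upwards [hne] with x hx
      have h0 := besselKernel_nonneg hb x
      rw [norm_of_nonneg (by positivity)]
      calc _ ≤ (C₁ * ‖x‖ ^ (-(2 * (c / 2)))) ^ r := by gcongr; exact h₁ x hx
        _ = _ := by
          rw [mul_rpow hC₁ (by positivity), ← rpow_mul (norm_nonneg _)]
          congr 2; ring
  have hcompl : IntegrableOn (fun x : Eucl n => besselKernel b x ^ r) (Metric.ball 0 1)ᶜ := by
    have hi : Integrable fun x : Eucl n => (C₂ * 2 ^ (2 * (n : ℝ))) ^ r *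
        (1 + ‖x‖) ^ (-(2 * (n : ℝ) * r)) := by
      refine (integrable_one_add_norm ?_).const_mul _
      rw [finrank_euclideanSpace_fin]; nlinarith
    refine hi.integrableOn.mono' hm.restrict ?_
    filter_upwards [ae_restrict_mem Metric.isOpen_ball.measurableSet.compl] with x hx
    have hx1 : 1 ≤ ‖x‖ := by simpa using hx
    have hx0 : x ≠ 0 := norm_pos_iff.1 (by linarith)
    have h0 := besselKernel_nonneg hb x
    rw [norm_of_nonneg (by positivity)]
    have h3 : ‖x‖ ^ (-(2 * (n : ℝ))) ≤ 2 ^ (2 * (n : ℝ)) * (1 + ‖x‖) ^ (-(2 * (n : ℝ))) := by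
      have : ((1 + ‖x‖) / 2) ^ (2 * (n : ℝ)) ≤ ‖x‖ ^ (2 * (n : ℝ)) := by
        gcongr; linarith
      rw [rpow_neg (by positivity), rpow_neg (by positivity), ← div_eq_mul_inv,
        ← inv_div, ← div_rpow (by positivity) (by positivity)]
      exact inv_anti₀ (by positivity) this
    calc _ ≤ (C₂ * (2 ^ (2 * (n : ℝ)) * (1 + ‖x‖) ^ (-(2 * (n : ℝ))))) ^ r := by
          gcongr; exact (h₂ x hx0).trans (by gcongr)
      _ = _ := by
          rw [← mul_assoc, mul_rpow (by positivity) (by positivity),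
            ← rpow_mul (by positivity)]
          congr 2; ring
  have hint : Integrable fun x : Eucl n => besselKernel b x ^ r := by
    rw [← integrableOn_univ, ← union_compl_self (Metric.ball (0 : Eucl n) 1)]
    exact hball.union hcompl
  refine lt_of_le_of_lt (le_of_eq ?_) hint.lintegral_lt_top
  refine lintegral_congr fun x => ?_
  rw [ENNReal.ofReal_rpow_of_nonneg (besselKernel_nonneg hb x) hr0.le]

/-- Young's convolution inequality. -/
theorem lintegral_rpow_convolution_le {G : Type*} [AddCommGroup G] [MeasurableSpace G]
    [MeasurableAdd₂ G] [MeasurableNeg G] {μ : Measure G} [SFinite μ] [μ.IsAddLeftInvariant]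
    [μ.IsNegInvariant] {p q r : ℝ} (hp : 0 < p) (hq : 1 ≤ q) (hr : 1 ≤ r)
    (h : 1 / q + 1 / r = 1 + 1 / p) {f g : G → ℝ≥0∞} (hf : Measurable f) (hg : Measurable g) :
    ∫⁻ x, (∫⁻ y, f y * g (x - y) ∂μ) ^ p ∂μ ≤
      (∫⁻ x, f x ^ q ∂μ) ^ (p / q) * (∫⁻ x, g x ^ r ∂μ) ^ (p / r) := by
  have hq0 : 0 < q := by linarith
  have hr0 : 0 < r := by linarith
  have hq1 : 1 / q ≤ 1 := by rwa [div_le_one hq0]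
  have hr1 : 1 / r ≤ 1 := by rwa [div_le_one hr0]
  have hp0 : 0 < 1 / p := by positivity
  set A := ∫⁻ x, f x ^ q ∂μ with hA
  set B := ∫⁻ x, g x ^ r ∂μ with hB
  have hsub : Measurable fun z : G × G => z.1 - z.2 := by
    simp_rw [sub_eq_add_neg]; exact measurable_fst.add measurable_snd.neg
  have hgx : ∀ x, Measurable fun y => g (x - y) := fun x =>
    hg.comp (hsub.comp (measurable_const.prodMk measurable_id))
  -- Hölder with three functions, from `f g = (f^q g^r)^(1/p) (f^q)^(1/q - 1/p) (g^r)^(1/r - 1/p)`;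
  -- the three exponents sum to 1 by `h`.
  have pointwise : ∀ x, (∫⁻ y, f y * g (x - y) ∂μ) ^ p ≤
      (∫⁻ y, f y ^ q * g (x - y) ^ r ∂μ) * (A ^ (p / q - 1) * B ^ (p / r - 1)) := by
    intro x
    let F : Fin 3 → G → ℝ≥0∞ :=
      ![fun y => f y ^ q * g (x - y) ^ r, fun y => f y ^ q, fun y => g (x - y) ^ r]
    let e : Fin 3 → ℝ := ![1 / p, 1 / q - 1 / p, 1 / r - 1 / p]
    have hH := ENNReal.lintegral_prod_norm_pow_le (μ := μ) Finset.univ (f := F) (p := e)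
      (fun i _ => by
        fin_cases i
        · exact ((hf.pow_const q).mul ((hgx x).pow_const r)).aemeasurable
        · exact (hf.pow_const q).aemeasurable
        · exact ((hgx x).pow_const r).aemeasurable)
      (by simp only [e, Fin.sum_univ_three, Matrix.cons_val]; linarith)
      (fun i _ => by
        fin_cases i <;> simp only [e, Fin.zero_eta, Fin.mk_one, Fin.reduceFinMk, Matrix.cons_val] <;>
          linarith)
    simp only [Fin.prod_univ_three, F, e, Matrix.cons_val] at hH
    have hprod : ∀ y, (f y ^ q * g (x - y) ^ r) ^ (1 / p) * (f y ^ q) ^ (1 / q - 1 / p) *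
        (g (x - y) ^ r) ^ (1 / r - 1 / p) = f y * g (x - y) := by
      intro y
      have hx1 : ∀ (c : ℝ≥0∞) (s : ℝ), 0 < s → 0 ≤ 1 / s - 1 / p →
          (c ^ s) ^ (1 / p) * (c ^ s) ^ (1 / s - 1 / p) = c := by
        intro c s hs hsp
        rw [← ENNReal.rpow_add_of_nonneg _ _ hp0.le hsp, ← ENNReal.rpow_mul]
        have : s * (1 / p + (1 / s - 1 / p)) = 1 := by field_simp; ring
        rw [this, ENNReal.rpow_one]
      rw [ENNReal.mul_rpow_of_nonneg _ _ hp0.le]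
      calc _ = ((f y ^ q) ^ (1 / p) * (f y ^ q) ^ (1 / q - 1 / p)) *
            ((g (x - y) ^ r) ^ (1 / p) * (g (x - y) ^ r) ^ (1 / r - 1 / p)) := by ring
        _ = _ := by rw [hx1 _ q hq0 (by linarith), hx1 _ r hr0 (by linarith)]
    simp_rw [hprod] at hH
    rw [lintegral_sub_left_eq_self (fun y => g y ^ r) x] at hH
    refine (ENNReal.rpow_le_rpow hH hp.le).trans (le_of_eq ?_)
    rw [ENNReal.mul_rpow_of_nonneg _ _ hp.le, ENNReal.mul_rpow_of_nonneg _ _ hp.le,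
      ← ENNReal.rpow_mul, ← ENNReal.rpow_mul, ← ENNReal.rpow_mul, mul_assoc]
    have e1 : 1 / p * p = 1 := by field_simp
    have e2 : (1 / q - 1 / p) * p = p / q - 1 := by field_simp
    have e3 : (1 / r - 1 / p) * p = p / r - 1 := by field_simp
    rw [e1, e2, e3, ENNReal.rpow_one]
  have hpq : 0 ≤ p / q - 1 := by
    have : p / q - 1 = (1 / q - 1 / p) * p := by field_simp
    rw [this]; exact mul_nonneg (by linarith) hp.le
  have hpr : 0 ≤ p / r - 1 := by
    have : p / r - 1 = (1 / r - 1 / p) * p := by field_simp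
    rw [this]; exact mul_nonneg (by linarith) hp.le
  have hmeas : Measurable fun z : G × G => f z.2 ^ q * g (z.1 - z.2) ^ r :=
    ((hf.comp measurable_snd).pow_const q).mul ((hg.comp hsub).pow_const r)
  calc _ ≤ ∫⁻ x, (∫⁻ y, f y ^ q * g (x - y) ^ r ∂μ) * (A ^ (p / q - 1) * B ^ (p / r - 1)) ∂μ :=
        lintegral_mono pointwise
    _ = (∫⁻ x, ∫⁻ y, f y ^ q * g (x - y) ^ r ∂μ ∂μ) * (A ^ (p / q - 1) * B ^ (p / r - 1)) :=
        lintegral_mul_const _ hmeas.lintegral_prod_right'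
    -- Tonelli and translation invariance: the convolution of `f^q` and `g^r` has integral `A * B`.
    _ = (A * B) * (A ^ (p / q - 1) * B ^ (p / r - 1)) := by
        rw [lintegral_lintegral_swap hmeas.aemeasurable]
        congr 1
        rw [hA, ← lintegral_mul_const _ (hf.pow_const q)]
        refine lintegral_congr fun y => ?_
        have hgy : Measurable fun x => g (x - y) :=
          hg.comp (hsub.comp (measurable_id.prodMk measurable_const))
        rw [lintegral_const_mul _ (hgy.pow_const r)]
        congr 1
        exact lintegral_sub_right_eq_self (fun x => g x ^ r) y
    _ = (A ^ (1 : ℝ) * A ^ (p / q - 1)) * (B ^ (1 : ℝ) * B ^ (p / r - 1)) := by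
        rw [ENNReal.rpow_one, ENNReal.rpow_one]; ring
    _ = _ := by
        rw [← ENNReal.rpow_add_of_nonneg _ _ zero_le_one hpq,
          ← ENNReal.rpow_add_of_nonneg _ _ zero_le_one hpr]
        congr 2 <;> ring

theorem lintegral_schwartz_rpow_lt_top (u : 𝓢(Eucl n, ℂ)) {p : ℝ} (hp : 0 < p) :
    ∫⁻ x, ‖u x‖ₑ ^ p < ∞ := by
  have h := (u.memLp (ENNReal.ofReal p) volume).2
  rwa [eLpNorm_lt_top_iff_lintegral_rpow_enorm_lt_top (by simpa using hp) ENNReal.ofReal_ne_top,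
    ENNReal.toReal_ofReal hp.le] at h

theorem eLpNorm_ofReal_eq_lintegral {f : Eucl n → ℂ} {p : ℝ} (hp : 0 < p) :
    eLpNorm f (ENNReal.ofReal p) = (∫⁻ x, ‖f x‖ₑ ^ p) ^ (1 / p) := by
  rw [eLpNorm_eq_lintegral_rpow_enorm_toReal (by simpa using hp) ENNReal.ofReal_ne_top,
    ENNReal.toReal_ofReal hp.le]

/-- The function `g` is the convolution of `f` with the Bessel kernel, bounded by Young. That it
represents the potential is checked against Schwartz functions, by moving the multiplier onto them
and applying Fubini. -/
theorem exists_besselPotential_neg_eq {b p q r : ℝ} (hn : 0 < n) (hb : 0 < b) (hp : 1 < p)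
    (hq : 1 ≤ q) (hr : 1 ≤ r) (h : 1 / q + 1 / r = 1 + 1 / p) (hbr : ((n : ℝ) - b) * r < n)
    [Fact (1 ≤ ENNReal.ofReal p)] [Fact (1 ≤ ENNReal.ofReal q)] :
    ∃ C : ℝ≥0∞, C ≠ ∞ ∧ ∀ f : Eucl n → ℂ, Measurable f →
      ∀ hf : MemLp f (ENNReal.ofReal q), ∃ g : Lp ℂ (ENNReal.ofReal p) (volume : Measure (Eucl n)),
        besselPotential (Eucl n) ℂ (-b) (hf.toLp f : 𝓢'(Eucl n, ℂ)) = (g : 𝓢'(Eucl n, ℂ)) ∧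
          ‖g‖ₑ ≤ C * eLpNorm f (ENNReal.ofReal q) := by
  have hp0 : 0 < p := by linarith
  have hq0 : 0 < q := by linarith
  have hr0 : 0 < r := by linarith
  have hB := lintegral_besselKernel_rpow_lt_top hn hb hr hbr
  set K : Eucl n → ℝ≥0∞ := fun x => ENNReal.ofReal (besselKernel b x) with hK
  have hKm : Measurable K := (measurable_besselKernel b).ennreal_ofReal
  set B := ∫⁻ x, K x ^ r with hBdef
  refine ⟨B ^ (1 / r), ENNReal.rpow_ne_top_of_nonneg (by positivity) hB.ne, fun f hfm hf => ?_⟩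
  set A := ∫⁻ x, ‖f x‖ₑ ^ q with hA
  have hAfin : A < ∞ := by
    have := hf.2
    rwa [eLpNorm_lt_top_iff_lintegral_rpow_enorm_lt_top (by simpa using hq0)
      ENNReal.ofReal_ne_top, ENNReal.toReal_ofReal hq0.le] at this
  have young := lintegral_rpow_convolution_le (μ := (volume : Measure (Eucl n))) hp0 hq hr h
    (f := fun x => ‖f x‖ₑ) (g := K) hfm.enorm hKm
  set k : Eucl n → ℂ := fun y => ∫ x, (besselKernel b (x - y) : ℂ) * f x with hk
  have hjoint : Measurable fun z : Eucl n × Eucl n => (besselKernel b (z.1 - z.2) : ℂ) := by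
    have := (measurable_besselKernel (n := n) b).comp
      (measurable_fst.sub measurable_snd : Measurable fun z : Eucl n × Eucl n => z.1 - z.2)
    exact Complex.measurable_ofReal.comp this
  have hkm : AEStronglyMeasurable k := by
    have : Measurable fun z : Eucl n × Eucl n => (besselKernel b (z.2 - z.1) : ℂ) * f z.2 :=
      (hjoint.comp measurable_swap).mul (hfm.comp measurable_snd)
    exact this.stronglyMeasurable.integral_prod_right'.aestronglyMeasurable
  have henorm : ∀ x y : Eucl n, ‖(besselKernel b (x - y) : ℂ) * f x‖ₑ = ‖f x‖ₑ * K (y - x) := by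
    intro x y
    rw [enorm_mul, mul_comm, hK, ← neg_sub y x, besselKernel_neg]
    congr 1
    rw [← ofReal_norm, Complex.norm_real, norm_of_nonneg (besselKernel_nonneg hb _)]
  have hk_le : ∀ y, ‖k y‖ₑ ≤ ∫⁻ x, ‖f x‖ₑ * K (y - x) := by
    intro y
    refine (enorm_integral_le_lintegral_enorm _).trans (le_of_eq ?_)
    exact lintegral_congr fun x => henorm x y
  have hAB : (A ^ (p / q) * B ^ (p / r)) ^ (1 / p) = B ^ (1 / r) * A ^ (1 / q) := by
    rw [ENNReal.mul_rpow_of_nonneg _ _ (by positivity), ← ENNReal.rpow_mul, ← ENNReal.rpow_mul,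
      mul_comm]
    congr 2 <;> field_simp
  have hABfin : A ^ (p / q) * B ^ (p / r) < ∞ :=
    ENNReal.mul_lt_top (ENNReal.rpow_lt_top_of_nonneg (by positivity) hAfin.ne)
      (ENNReal.rpow_lt_top_of_nonneg (by positivity) hB.ne)
  have hk_norm : eLpNorm k (ENNReal.ofReal p) ≤ B ^ (1 / r) * eLpNorm f (ENNReal.ofReal q) := by
    rw [eLpNorm_ofReal_eq_lintegral hp0, eLpNorm_ofReal_eq_lintegral hq0, ← hA, ← hAB]
    gcongr
    refine le_trans (lintegral_mono fun y => ?_) young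
    gcongr
    exact hk_le y
  have hk_mem : MemLp k (ENNReal.ofReal p) :=
    ⟨hkm, hk_norm.trans_lt (ENNReal.mul_lt_top
      (ENNReal.rpow_lt_top_of_nonneg (by positivity) hB.ne) hf.2)⟩
  refine ⟨hk_mem.toLp k, ?_, ?_⟩
  · ext u
    have hu_int : Integrable (fun z : Eucl n × Eucl n =>
        ((besselKernel b (z.1 - z.2) : ℂ) * u z.2) * f z.1) (volume.prod volume) := by
      have hm : Measurable fun z : Eucl n × Eucl n =>
          ((besselKernel b (z.1 - z.2) : ℂ) * u z.2) * f z.1 :=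
        (hjoint.mul (u.continuous.measurable.comp measurable_snd)).mul (hfm.comp measurable_fst)
      refine ⟨hm.aestronglyMeasurable, ?_⟩
      rw [hasFiniteIntegral_iff_enorm, lintegral_prod_symm _ hm.enorm.aemeasurable]
      have e : ∀ y x : Eucl n, ‖((besselKernel b (x - y) : ℂ) * u y) * f x‖ₑ =
          ‖u y‖ₑ * (‖f x‖ₑ * K (y - x)) := by
        intro y x
        rw [← henorm, ← enorm_mul]; congr 1; ring
      simp_rw [e]
      have hfx : ∀ y, Measurable fun x => ‖f x‖ₑ * K (y - x) := fun y =>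
        hfm.enorm.mul (hKm.comp (measurable_const.sub measurable_id))
      have hconv : Measurable fun y => ∫⁻ x, ‖f x‖ₑ * K (y - x) := by
        have : Measurable fun z : Eucl n × Eucl n => ‖f z.2‖ₑ * K (z.1 - z.2) :=
          (hfm.comp measurable_snd).enorm.mul (hKm.comp (measurable_fst.sub measurable_snd))
        exact this.lintegral_prod_right'
      have e2 : ∀ y, ∫⁻ x, ‖u y‖ₑ * (‖f x‖ₑ * K (y - x)) =
          ‖u y‖ₑ * ∫⁻ x, ‖f x‖ₑ * K (y - x) := fun y => lintegral_const_mul _ (hfx y)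
      simp_rw [e2]
      -- Absolute convergence of the double integral: Hölder between `u` in the conjugate space and
      -- `|f| * K` (convolution) in `L^p`. The conjugate exponent is finite because `1 < p`.
      have hpp : (p.conjExponent).HolderConjugate p := (Real.HolderConjugate.conjExponent hp).symm
      refine (ENNReal.lintegral_mul_le_Lp_mul_Lq volume hpp
        u.continuous.measurable.enorm.aemeasurable hconv.aemeasurable).trans_lt ?_
      exact ENNReal.mul_lt_top
        (ENNReal.rpow_lt_top_of_nonneg (by have := hpp.pos; positivity)
          (lintegral_schwartz_rpow_lt_top u hpp.pos).ne)
        (ENNReal.rpow_lt_top_of_nonneg (by positivity) (young.trans_lt hABfin).ne)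
    rw [besselPotential, TemperedDistribution.fourierMultiplierCLM_apply_apply,
      Lp.toTemperedDistribution_apply, Lp.toTemperedDistribution_apply]
    have e1 : ∫ x, (𝓕 (SchwartzMap.smulLeftCLM ℂ
        (fun ξ : Eucl n => (((1 + ‖ξ‖ ^ 2) ^ (-b / 2) : ℝ) : ℂ)) (𝓕⁻ u))) x • (hf.toLp f) x =
        ∫ x, ∫ y, ((besselKernel b (x - y) : ℂ) * u y) * f x := by
      refine integral_congr_ae ?_
      filter_upwards [hf.coeFn_toLp] with x hx
      rw [hx, fourier_smulLeft_fourierInv_eq_integral hb, smul_eq_mul, integral_mul_const]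
    rw [e1, integral_integral_swap hu_int]
    refine integral_congr_ae ?_
    filter_upwards [hk_mem.coeFn_toLp] with y hy
    rw [hy, smul_eq_mul, hk, ← integral_const_mul]
    refine integral_congr_ae (ae_of_all _ fun x => ?_)
    beta_reduce
    ring
  · rw [Lp.enorm_toLp]
    exact hk_norm

/-! ### Regular distributions and their products with test functions -/

theorem regular_apply {g : Eucl n → ℂ} (hg : LocallyIntegrable g) (φ : Test n) :
    regular g φ = ∫ x, φ x * g x := by
  have h : LocallyIntegrableOn g ((⊤ : Opens (Eucl n)) : Set (Eucl n)) volume :=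
    hg.locallyIntegrableOn _
  rw [regular, TestFunction.integralAgainstBilinCLM_eq_integral h]
  rfl

theorem mulDist_regular_apply {g : Eucl n → ℂ} (hg : LocallyIntegrable g) (f φ : Test n) :
    mulDist f (regular g) φ = ∫ x, (f x * φ x) * g x :=
  regular_apply hg (mulTest f φ)

theorem toDist_toLp_eq_mulDist_regular {q : ℝ≥0∞} [Fact (1 ≤ q)] {g : Eucl n → ℂ}
    (hg : LocallyIntegrable g) (f : Test n) (h : MemLp (fun x => f x * g x) q) :
    toDist (h.toLp _ : 𝓢'(Eucl n, ℂ)) = mulDist f (regular g) := by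
  ext φ
  rw [mulDist_regular_apply hg]
  refine (Lp.toTemperedDistribution_apply (h.toLp _) (toSchwartz φ)).trans ?_
  refine integral_congr_ae ?_
  filter_upwards [h.coeFn_toLp] with x hx
  rw [hx, smul_eq_mul]
  change φ x * (f x * g x) = _
  ring

/-- The embedding of `L^q` into the Bessel potential space of order `-b` and exponent `p`. -/
theorem exists_besselPotential_neg_le {b p q : ℝ} (hn : 0 < n) (hp : 1 < p) (hq : 1 ≤ q)
    (h : (b = 0 ∧ q = p) ∨ (0 < b ∧ 1 / p ≤ 1 / q ∧ 1 / q - 1 / p < b / n))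
    [Fact (1 ≤ ENNReal.ofReal p)] [Fact (1 ≤ ENNReal.ofReal q)] :
    ∃ C : ℝ≥0∞, C ≠ ∞ ∧ ∀ f : Eucl n → ℂ, Measurable f →
      ∀ hf : MemLp f (ENNReal.ofReal q), ∃ g : Lp ℂ (ENNReal.ofReal p) (volume : Measure (Eucl n)),
        besselPotential (Eucl n) ℂ (-b) (hf.toLp f : 𝓢'(Eucl n, ℂ)) = (g : 𝓢'(Eucl n, ℂ)) ∧
          ‖g‖ₑ ≤ C * eLpNorm f (ENNReal.ofReal q) := by
  rcases h with ⟨rfl, rfl⟩ | ⟨hb, h1, h2⟩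
  · refine ⟨1, ENNReal.one_ne_top, fun f _ hf => ⟨hf.toLp f, by simp, ?_⟩⟩
    rw [one_mul, Lp.enorm_toLp]
  · have hn' : (0 : ℝ) < n := by exact_mod_cast hn
    have hq1 : 1 / q ≤ 1 := by rwa [div_le_one (by linarith)]
    have hp0 : 0 < 1 / p := by positivity
    have hs : 0 < 1 - (1 / q - 1 / p) := by linarith
    -- Young's relation forces this `r`; then `(n - b) * r < n` says exactly that `1/q - 1/p < b/n`.
    refine exists_besselPotential_neg_eq (r := 1 / (1 - (1 / q - 1 / p))) hn hb hp hq ?_ ?_ ?_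
    · rw [le_div_iff₀ hs]; linarith
    · rw [one_div_one_div]; ring
    · rw [mul_one_div, div_lt_iff₀ hs]
      rw [lt_div_iff₀ hn'] at h2
      nlinarith

/-! ### Power functions in the uniformly localized spaces -/

theorem norm_powerFun_le (α : ℝ) (x : Eucl n) : ‖powerFun n α x‖ ≤ ‖x‖ ^ (-α) := by
  unfold powerFun
  split_ifs with h
  · rw [norm_zero]; positivity
  · rw [Complex.norm_real, norm_of_nonneg (by positivity)]

theorem measurable_powerFun (α : ℝ) : Measurable (powerFun n α) := by
  unfold powerFun
  refine Measurable.ite (measurableSet_singleton 0) measurable_const ?_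
  fun_prop

theorem locallyIntegrable_powerFun {α : ℝ} (hn : 0 < n) (hα : α < n) :
    LocallyIntegrable (powerFun n α) :=
  locallyIntegrable_of_norm_le_rpow (C := 1) (by simpa using Nat.succ_le_of_lt hn)
    (by simpa using hα) (ae_of_all _ fun x => by simpa using norm_powerFun_le α x)
    (measurable_powerFun α).aestronglyMeasurable

theorem memLp_indicator_powerFun {α q : ℝ} (hn : 0 < n) (hq : 1 ≤ q) (hα : α * q < n) :
    MemLp ((Metric.ball (0 : Eucl n) 1).indicator (powerFun n α)) (ENNReal.ofReal q) := by
  have hq0 : 0 < q := by linarith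
  have hm := (measurable_powerFun (n := n) α).aestronglyMeasurable (μ := volume)
  rw [memLp_indicator_iff_restrict Metric.isOpen_ball.measurableSet,
    ← integrable_norm_rpow_iff hm.restrict (by simpa using hq0) ENNReal.ofReal_ne_top,
    ENNReal.toReal_ofReal hq0.le]
  refine integrableOn_ball_of_norm_le_rpow (C := 1) (α := α * q)
    (by simpa using Nat.succ_le_of_lt hn) (by simpa using hα)
    (ae_restrict_of_ae (ae_of_all _ fun x => ?_)) (by
      exact ((measurable_powerFun α).norm.pow_const q).aestronglyMeasurable)
  rw [norm_of_nonneg (by positivity), one_mul, ← neg_mul, rpow_mul (norm_nonneg _)]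
  gcongr
  exact norm_powerFun_le α x

/-- Inside the unit ball `f` is at most `M`; outside, the power is at most 1 since `0 ≤ α`. The
bound sees `f` only through `M` and its `L^q` norm, both unchanged by translation. -/
theorem eLpNorm_mul_powerFun_le {α M : ℝ} {q : ℝ≥0∞} (hα : 0 ≤ α) (hM : 0 ≤ M) (hq : 1 ≤ q)
    {f : Eucl n → ℂ} (hf : Measurable f) (hfM : ∀ x, ‖f x‖ ≤ M) :
    eLpNorm (fun x => f x * powerFun n α x) q ≤
      ENNReal.ofReal M * eLpNorm ((Metric.ball (0 : Eucl n) 1).indicator (powerFun n α)) q +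
        eLpNorm f q := by
  have hgm : Measurable ((Metric.ball (0 : Eucl n) 1).indicator (powerFun n α)) :=
    (measurable_powerFun α).indicator Metric.isOpen_ball.measurableSet
  revert hgm
  generalize hg : (Metric.ball (0 : Eucl n) 1).indicator (powerFun n α) = g
  intro hgm
  have h1 : eLpNorm (fun x => f x * powerFun n α x) q volume ≤
      eLpNorm ((M • fun x => ‖g x‖) + fun x => ‖f x‖) q volume := by
    refine eLpNorm_mono_real fun x => ?_
    rw [norm_mul]
    change _ ≤ M * ‖g x‖ + ‖f x‖
    by_cases hx : x ∈ Metric.ball (0 : Eucl n) 1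
    · rw [← hg, indicator_of_mem hx]
      exact (mul_le_mul_of_nonneg_right (hfM x) (norm_nonneg _)).trans
        (le_add_of_nonneg_right (norm_nonneg _))
    · rw [← hg, indicator_of_notMem hx, norm_zero, mul_zero, zero_add]
      refine mul_le_of_le_one_right (norm_nonneg _) ((norm_powerFun_le α x).trans ?_)
      exact rpow_le_one_of_one_le_of_nonpos (by simpa using hx) (by linarith)
  have h2 := eLpNorm_add_le (hgm.norm.aestronglyMeasurable.const_smul M)
    (hf.norm.aestronglyMeasurable (μ := volume)) hq
  rw [eLpNorm_norm, eLpNorm_const_smul, eLpNorm_norm, ← ofReal_norm, norm_of_nonneg hM] at h2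
  exact h1.trans h2

theorem memLp_test (f : Test n) (q : ℝ≥0∞) : MemLp (f : Eucl n → ℂ) q :=
  (toSchwartz f).memLp q volume

theorem exists_norm_test_le (f : Test n) : ∃ M : ℝ, 0 ≤ M ∧ ∀ x, ‖f x‖ ≤ M :=
  ⟨_, norm_nonneg _, fun x => (toSchwartz f).toBoundedContinuousFunction.norm_coe_le_norm x⟩

theorem measurable_test (f : Test n) : Measurable (f : Eucl n → ℂ) :=
  f.contDiff.continuous.measurable

theorem IsCutoff.norm_le_one {η : Test n} (hη : IsCutoff η) (x : Eucl n) : ‖η x‖ ≤ 1 := by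
  obtain ⟨r, hr, h⟩ := hη.1 x
  rw [h, Complex.norm_real, norm_of_nonneg hr.1]
  exact hr.2

theorem eLpNorm_translate (z : Eucl n) (η : Test n) (q : ℝ≥0∞) :
    eLpNorm (translate z η : Eucl n → ℂ) q = eLpNorm (η : Eucl n → ℂ) q :=
  eLpNorm_comp_measurePreserving (measurable_test η).aestronglyMeasurable
    (measurePreserving_sub_right volume z)

theorem regular_powerFun_mem_besselUnif {α b p q : ℝ} (hn : 0 < n) (hα : 0 ≤ α) (hαn : α < n)
    (hp : 1 < p) (hq : 1 ≤ q) (hαq : α * q < n)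
    (h : (b = 0 ∧ q = p) ∨ (0 < b ∧ 1 / p ≤ 1 / q ∧ 1 / q - 1 / p < b / n))
    {η : Test n} (hη : IsCutoff η) :
    regular (powerFun n α) ∈ besselUnif (-b) (ENNReal.ofReal p) η := by
  have hp' : Fact (1 ≤ ENNReal.ofReal p) := ⟨by simpa using hp.le⟩
  have hq' : Fact (1 ≤ ENNReal.ofReal q) := ⟨by simpa using hq⟩
  obtain ⟨C, hC, hbound⟩ := exists_besselPotential_neg_le hn hp hq h
  have hloc := locallyIntegrable_powerFun hn hαn
  have hP := memLp_indicator_powerFun hn hq hαq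
  set P := eLpNorm ((Metric.ball (0 : Eucl n) 1).indicator (powerFun n α)) (ENNReal.ofReal q)
  -- One estimate serves twice: for arbitrary `f` it gives local membership, and for the translates
  -- of `η`, with `M = 1`, a bound independent of `z`.
  have key : ∀ (f : Test n) (M : ℝ), 0 ≤ M → (∀ x, ‖f x‖ ≤ M) →
      MemBessel (-b) (ENNReal.ofReal p) (mulDist f (regular (powerFun n α))) ∧
      besselNorm (-b) (ENNReal.ofReal p) (mulDist f (regular (powerFun n α))) ≤
        C * (ENNReal.ofReal M * P + eLpNorm (f : Eucl n → ℂ) (ENNReal.ofReal q)) := by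
    intro f M hM hfM
    have hle := eLpNorm_mul_powerFun_le hα hM hq'.out (measurable_test f) hfM
    have hm : Measurable fun x => f x * powerFun n α x :=
      (measurable_test f).mul (measurable_powerFun α)
    have hmem : MemLp (fun x => f x * powerFun n α x) (ENNReal.ofReal q) :=
      ⟨hm.aestronglyMeasurable, hle.trans_lt (ENNReal.add_lt_top.2
        ⟨ENNReal.mul_lt_top ENNReal.ofReal_lt_top hP.2, (memLp_test f _).2⟩)⟩
    obtain ⟨g, hg, hgn⟩ := hbound _ hm hmem
    have hd := toDist_toLp_eq_mulDist_regular hloc f hmem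
    refine ⟨⟨_, hd, hp', g, hg⟩, ?_⟩
    have hnorm : besselNorm (-b) (ENNReal.ofReal p) (mulDist f (regular (powerFun n α))) ≤ ‖g‖ₑ := by
      refine iInf_le_of_le (hmem.toLp _ : 𝓢'(Eucl n, ℂ)) ?_
      refine iInf_le_of_le hd ?_
      refine iInf_le_of_le hp' ?_
      refine iInf_le_of_le g ?_
      exact iInf_le_of_le hg le_rfl
    refine hnorm.trans ?_
    exact hgn.trans (by gcongr)
  refine ⟨fun f => ?_, ?_⟩
  · obtain ⟨M, hM, hfM⟩ := exists_norm_test_le f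
    exact (key f M hM hfM).1
  · refine (iSup_le fun z => ?_ : _ ≤ C * (ENNReal.ofReal 1 * P +
      eLpNorm (η : Eucl n → ℂ) (ENNReal.ofReal q))).trans_lt ?_
    · have := (key (translate z η) 1 zero_le_one fun x => hη.norm_le_one _).2
      rwa [eLpNorm_translate] at this
    · exact ENNReal.mul_lt_top hC.lt_top (ENNReal.add_lt_top.2
        ⟨ENNReal.mul_lt_top ENNReal.ofReal_lt_top hP.2, (memLp_test η _).2⟩)

/-! ### Sobolev norms of test functions and duality -/

/-- The norm of a Schwartz function in the Bessel potential space of order `s` and exponent two,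
on the Fourier side. -/
def sobolevENorm (s : ℝ) (ψ : 𝓢(Eucl n, ℂ)) : ℝ≥0∞ :=
  eLpNorm (fun ξ => (((1 + ‖ξ‖ ^ 2) ^ (s / 2) : ℝ) : ℂ) * 𝓕 ψ ξ) 2

theorem continuous_weight_mul_fourier (s : ℝ) (ψ : 𝓢(Eucl n, ℂ)) :
    Continuous fun ξ : Eucl n => (((1 + ‖ξ‖ ^ 2) ^ (s / 2) : ℝ) : ℂ) * 𝓕 ψ ξ := by
  have h : (fun ξ : Eucl n => (1 + ‖ξ‖ ^ 2) ^ (s / 2)).HasTemperateGrowth := by fun_prop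
  exact (Complex.continuous_ofReal.comp h.1.continuous).mul (𝓕 ψ).continuous

theorem enorm_toLp_fourier (ψ : 𝓢(Eucl n, ℂ)) : ‖(𝓕 ψ).toLp 2‖ₑ = ‖ψ.toLp 2‖ₑ := by
  rw [← ofReal_norm, ← ofReal_norm, SchwartzMap.norm_fourier_toL2_eq]

theorem enorm_toLp_fourierInv_smulLeft_fourier (s : ℝ) (ψ : 𝓢(Eucl n, ℂ)) :
    ‖(𝓕⁻ (SchwartzMap.smulLeftCLM ℂ (fun ξ : Eucl n => (((1 + ‖ξ‖ ^ 2) ^ (s / 2) : ℝ) : ℂ))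
      (𝓕 ψ))).toLp 2‖ₑ = sobolevENorm s ψ := by
  rw [← enorm_toLp_fourier, FourierTransform.fourier_fourierInv_eq, SchwartzMap.toLp,
    Lp.enorm_toLp, sobolevENorm]
  refine eLpNorm_congr_ae (ae_of_all _ fun ξ => ?_)
  rw [SchwartzMap.smulLeftCLM_apply_apply (by fun_prop), smul_eq_mul]

theorem enorm_toLp_fourier_smulLeft_fourierInv (s : ℝ) (ψ : 𝓢(Eucl n, ℂ)) :
    ‖(𝓕 (SchwartzMap.smulLeftCLM ℂ (fun ξ : Eucl n => (((1 + ‖ξ‖ ^ 2) ^ (s / 2) : ℝ) : ℂ))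
      (𝓕⁻ ψ))).toLp 2‖ₑ = sobolevENorm s ψ := by
  rw [enorm_toLp_fourier, SchwartzMap.toLp, Lp.enorm_toLp, sobolevENorm]
  rw [← eLpNorm_comp_measurePreserving (continuous_weight_mul_fourier s ψ).aestronglyMeasurable
    (Measure.measurePreserving_neg (volume : Measure (Eucl n)))]
  refine eLpNorm_congr_ae (ae_of_all _ fun ξ => ?_)
  rw [SchwartzMap.smulLeftCLM_apply_apply (by fun_prop), smul_eq_mul, Function.comp_apply, norm_neg,
    SchwartzMap.fourierInv_coe, SchwartzMap.fourier_coe, Real.fourierInv_eq_fourier_neg]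

theorem sobolevENorm_ne_top (s : ℝ) (ψ : 𝓢(Eucl n, ℂ)) : sobolevENorm s ψ ≠ ∞ := by
  rw [← enorm_toLp_fourier_smulLeft_fourierInv]
  exact enorm_ne_top

/-- Only this inequality is needed: `besselNorm` is an infimum, and the test function itself
provides one admissible pair. Plancherel gives its value. -/
theorem besselNorm_regular_le (s : ℝ) (f : Test n) :
    besselNorm s 2 (regular (f : Eucl n → ℂ)) ≤ sobolevENorm s (toSchwartz f) := by
  have hd : toDist (toSchwartz f : 𝓢'(Eucl n, ℂ)) = regular (f : Eucl n → ℂ) := by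
    ext φ
    rw [regular_apply f.contDiff.continuous.locallyIntegrable]
    exact SchwartzMap.coe_apply (toSchwartz f) (toSchwartz φ)
  have hm : (fun ξ : Eucl n => (((1 + ‖ξ‖ ^ 2) ^ (s / 2) : ℝ) : ℂ)).HasTemperateGrowth := by
    fun_prop
  rw [← enorm_toLp_fourierInv_smulLeft_fourier]
  unfold besselNorm
  refine iInf_le_of_le (toSchwartz f : 𝓢'(Eucl n, ℂ)) ?_
  refine iInf_le_of_le hd ?_
  refine iInf_le_of_le inferInstance ?_
  refine iInf_le_of_le ((𝓕⁻ (SchwartzMap.smulLeftCLM ℂ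
    (fun ξ : Eucl n => (((1 + ‖ξ‖ ^ 2) ^ (s / 2) : ℝ) : ℂ)) (𝓕 (toSchwartz f)))).toLp 2) ?_
  refine iInf_le_of_le ?_ le_rfl
  rw [besselPotential, Lp.toTemperedDistribution_toLp_eq,
    TemperedDistribution.fourierMultiplierCLM_toTemperedDistributionCLM_eq hm]
  rfl

/-- Duality of orders `-t` and `t`: the potential of order `t` is moved from `u` to `φ`, then
Cauchy-Schwarz and Plancherel apply. A majorant `N`, neither 0 nor `∞`, replaces the norm of `φ` so
that division by it commutes with passing to the infimum. -/
theorem enorm_apply_le_besselNorm_mul (t : ℝ) (u : Dist n) (φ : Test n) {N : ℝ≥0∞}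
    (hN : N ≠ 0) (hN' : N ≠ ∞) (hφ : sobolevENorm t (toSchwartz φ) ≤ N) :
    ‖u φ‖ₑ ≤ besselNorm (-t) 2 u * N := by
  rw [← ENNReal.div_le_iff hN hN']
  unfold besselNorm
  refine le_iInf fun v => le_iInf fun hv => le_iInf fun h2 => le_iInf fun g => le_iInf fun hg => ?_
  rw [ENNReal.div_le_iff hN hN']
  rw [besselPotential_neg_apply_eq_iff] at hg
  set w := 𝓕 (SchwartzMap.smulLeftCLM ℂ (fun ξ : Eucl n => (((1 + ‖ξ‖ ^ 2) ^ (t / 2) : ℝ) : ℂ))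
      (𝓕⁻ (toSchwartz φ))) with hw
  have huφ : u φ = ∫ x, w x * g x := by
    rw [← hv]
    change v (toSchwartz φ) = _
    rw [← hg, besselPotential, TemperedDistribution.fourierMultiplierCLM_apply_apply,
      Lp.toTemperedDistribution_apply]
    rfl
  have hwN : ‖w.toLp 2‖ₑ ≤ N := (enorm_toLp_fourier_smulLeft_fourierInv t _).trans_le hφ
  rw [huφ]
  have hholder := eLpNorm_smul_le_mul_eLpNorm (p := 2) (q := 2) (r := 1)
    (Lp.aestronglyMeasurable g) (w.continuous.aestronglyMeasurable (μ := volume))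
  have h1 : ‖∫ x, w x * g x‖ₑ ≤ eLpNorm ((w : Eucl n → ℂ) • (g : Eucl n → ℂ)) 1 volume := by
    rw [eLpNorm_one_eq_lintegral_enorm]
    exact enorm_integral_le_lintegral_enorm _
  rw [SchwartzMap.toLp, Lp.enorm_toLp] at hwN
  rw [← Lp.enorm_def, mul_comm] at hholder
  exact h1.trans (hholder.trans (mul_le_mul_right hwN _))

/-! ### Scaling and failure of the multiplier bound -/

/-- The dilation `x ↦ χ (x / l)` of a test function. -/
def dilate (l : ℝ) (hl : l ≠ 0) (χ : Test n) : Test n where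
  toFun x := χ (l⁻¹ • x)
  contDiff' := χ.contDiff.comp (contDiff_const_smul _)
  hasCompactSupport' := χ.hasCompactSupport.comp_homeomorph
    (Homeomorph.smulOfNeZero l⁻¹ (inv_ne_zero hl))
  tsupport_subset' := by simp

theorem fourier_dilate {l : ℝ} (hl : 0 < l) (χ : Test n) (ξ : Eucl n) :
    𝓕 (toSchwartz (dilate l hl.ne' χ)) ξ = ((l ^ n : ℝ) : ℂ) * 𝓕 (toSchwartz χ) (l • ξ) := by
  rw [SchwartzMap.fourier_coe, SchwartzMap.fourier_coe, Real.fourier_eq', Real.fourier_eq']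
  have h := Measure.integral_comp_inv_smul_of_nonneg (volume : Measure (Eucl n))
    (fun v => Complex.exp (↑(-2 * π * inner ℝ v (l • ξ)) * Complex.I) • χ v) hl.le
  rw [finrank_euclideanSpace_fin, Complex.real_smul] at h
  refine Eq.trans ?_ h
  refine integral_congr_ae (ae_of_all _ fun v => ?_)
  beta_reduce
  rw [inner_smul_left, inner_smul_right]
  have : (starRingEnd ℝ) l⁻¹ * (l * inner ℝ v ξ) = inner ℝ v ξ := by
    simp [hl.ne']
  rw [this]
  rfl

theorem eLpNorm_comp_smul {l : ℝ} (hl : 0 < l) {F : Eucl n → ℂ} (hF : Continuous F) :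
    eLpNorm (fun ξ => F (l • ξ)) 2 = ENNReal.ofReal (l ^ (-(n : ℝ) / 2)) * eLpNorm F 2 := by
  have hmap := Measure.map_addHaar_smul (volume : Measure (Eucl n)) hl.ne'
  have h : eLpNorm F 2 (Measure.map (l • ·) volume) = eLpNorm (F ∘ (l • ·)) 2 volume :=
    eLpNorm_map_measure hF.aestronglyMeasurable (measurable_const_smul l).aemeasurable
  change eLpNorm (F ∘ (l • ·)) 2 volume = _
  rw [← h, hmap, eLpNorm_smul_measure_of_ne_top (by norm_num), finrank_euclideanSpace_fin,
    smul_eq_mul, abs_of_nonneg (by positivity), ENNReal.ofReal_rpow_of_nonneg (by positivity)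
    (by positivity)]
  congr 2
  rw [← rpow_natCast, ← rpow_neg hl.le, ← rpow_mul hl.le]
  congr 1
  simp [div_eq_mul_inv]

/-- The transform of the dilate contributes `l^n`, the change of variables `l^(-n/2)`, and the
weight `l^(-s)`, because `1 + ‖ξ‖^2 ≤ l^(-2) (1 + ‖l ξ‖^2)` for `l ≤ 1`. -/
theorem sobolevENorm_dilate_le {s l : ℝ} (hs : 0 ≤ s) (hl : 0 < l) (hl1 : l ≤ 1) (χ : Test n) :
    sobolevENorm s (toSchwartz (dilate l hl.ne' χ)) ≤
      ENNReal.ofReal (l ^ ((n : ℝ) / 2 - s)) * sobolevENorm s (toSchwartz χ) := by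
  have hpt : ∀ ξ : Eucl n, (1 + ‖ξ‖ ^ 2) ^ (s / 2) ≤ l ^ (-s) * (1 + ‖l • ξ‖ ^ 2) ^ (s / 2) := by
    intro ξ
    have e : l ^ (-s) = (l⁻¹ ^ 2) ^ (s / 2) := by
      rw [← rpow_natCast, ← rpow_mul (by positivity), rpow_neg hl.le, inv_rpow hl.le]
      congr 2; push_cast; ring
    rw [e, ← mul_rpow (by positivity) (by positivity), norm_smul, norm_of_nonneg hl.le]
    have h1 : 1 ≤ l⁻¹ ^ 2 := one_le_pow₀ ((one_le_inv₀ hl).2 hl1)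
    have h2 : l⁻¹ ^ 2 * (1 + (l * ‖ξ‖) ^ 2) = l⁻¹ ^ 2 + ‖ξ‖ ^ 2 := by field_simp
    rw [h2]
    gcongr
  unfold sobolevENorm
  calc _ ≤ eLpNorm (((l ^ (n : ℝ) * l ^ (-s) : ℝ) : ℂ) • fun ξ : Eucl n =>
        (((1 + ‖l • ξ‖ ^ 2) ^ (s / 2) : ℝ) : ℂ) * 𝓕 (toSchwartz χ) (l • ξ)) 2 := by
        refine eLpNorm_mono fun ξ => ?_
        rw [fourier_dilate hl, Pi.smul_apply, smul_eq_mul]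
        simp only [norm_mul, Complex.norm_real]
        rw [norm_of_nonneg (by positivity : (0 : ℝ) ≤ (1 + ‖ξ‖ ^ 2) ^ (s / 2)),
          norm_of_nonneg (by positivity : (0 : ℝ) ≤ l ^ n),
          norm_of_nonneg (by positivity : (0 : ℝ) ≤ l ^ (n : ℝ)),
          norm_of_nonneg (by positivity : (0 : ℝ) ≤ l ^ (-s)),
          norm_of_nonneg (by positivity : (0 : ℝ) ≤ (1 + ‖l • ξ‖ ^ 2) ^ (s / 2)), rpow_natCast]
        calc _ ≤ (l ^ (-s) * (1 + ‖l • ξ‖ ^ 2) ^ (s / 2)) *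
              (l ^ n * ‖𝓕 (toSchwartz χ) (l • ξ)‖) := by gcongr; exact hpt ξ
          _ = _ := by ring
    _ = _ := by
        rw [eLpNorm_const_smul, eLpNorm_comp_smul hl (continuous_weight_mul_fourier s _), ← mul_assoc, ← ofReal_norm,
          Complex.norm_real, norm_of_nonneg (by positivity),
          ← ENNReal.ofReal_mul (by positivity), ← rpow_add hl, ← rpow_add hl]
        congr 3; ring

theorem powerFun_smul {l : ℝ} (hl : 0 < l) (α : ℝ) (x : Eucl n) :
    powerFun n α (l • x) = ((l ^ (-α) : ℝ) : ℂ) * powerFun n α x := by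
  unfold powerFun
  by_cases hx : x = 0
  · simp [hx]
  · rw [if_neg hx, if_neg (smul_ne_zero hl.ne' hx), norm_smul, norm_of_nonneg hl.le,
      mul_rpow hl.le (norm_nonneg _), Complex.ofReal_mul]

theorem mulDist_dilate_regular_powerFun {α l : ℝ} (hl : 0 < l)
    (hα : LocallyIntegrable (powerFun n α)) (χ : Test n) :
    mulDist (dilate l hl.ne' χ) (regular (powerFun n α)) (dilate l hl.ne' χ) =
      ((l ^ ((n : ℝ) - α) : ℝ) : ℂ) * mulDist χ (regular (powerFun n α)) χ := by
  rw [mulDist_regular_apply hα, mulDist_regular_apply hα]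
  have h := Measure.integral_comp_inv_smul_of_nonneg (volume : Measure (Eucl n))
    (fun v => (χ v * χ v) * powerFun n α (l • v)) hl.le
  rw [finrank_euclideanSpace_fin, Complex.real_smul] at h
  have e1 : ∀ x, (dilate l hl.ne' χ x * dilate l hl.ne' χ x) * powerFun n α x =
      (χ (l⁻¹ • x) * χ (l⁻¹ • x)) * powerFun n α (l • l⁻¹ • x) := by
    intro x
    rw [smul_inv_smul₀ hl.ne']
    rfl
  have e2 : ∀ v, (χ v * χ v) * powerFun n α (l • v) =
      ((l ^ (-α) : ℝ) : ℂ) * ((χ v * χ v) * powerFun n α v) := by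
    intro v
    rw [powerFun_smul hl]; ring
  simp_rw [e1]
  rw [h]
  simp_rw [e2]
  rw [integral_const_mul, ← mul_assoc, ← Complex.ofReal_mul, ← rpow_natCast, ← rpow_add hl,
    ← sub_eq_add_neg]

/-- The integrand is nonnegative and strictly positive on the punctured unit ball, where `χ = 1`. -/
theorem mulDist_regular_powerFun_ne_zero {α : ℝ} (hn : 0 < n)
    (hα : LocallyIntegrable (powerFun n α)) {χ : Test n} (hχ : IsCutoff χ) :
    mulDist χ (regular (powerFun n α)) χ ≠ 0 := by
  rw [mulDist_regular_apply hα]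
  have hint : Integrable fun x => (χ x * χ x) * powerFun n α x := by
    have := hα.integrable_smul_left_of_hasCompactSupport
      (χ.contDiff.continuous.mul χ.contDiff.continuous) (χ.hasCompactSupport.mul_left (f := χ))
    exact this
  have e : ∀ x, (χ x * χ x) * powerFun n α x = ((‖(χ x * χ x) * powerFun n α x‖ : ℝ) : ℂ) := by
    intro x
    obtain ⟨r, hr, h⟩ := hχ.1 x
    have : (χ x * χ x) * powerFun n α x = ((r * r * ‖powerFun n α x‖ : ℝ) : ℂ) := by
      rw [h, powerFun]
      split_ifs
      · simp
      · rw [Complex.norm_real, norm_of_nonneg (by positivity)]; push_cast; ring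
    have h0 : 0 ≤ r * r * ‖powerFun n α x‖ := by have := hr.1; positivity
    rw [this, Complex.norm_real, norm_of_nonneg h0]
  rw [integral_congr_ae (ae_of_all _ e), integral_complex_ofReal, Complex.ofReal_ne_zero]
  refine ne_of_gt ((integral_pos_iff_support_of_nonneg (fun x => norm_nonneg _) hint.norm).2 ?_)
  have hne : Nonempty (Fin n) := ⟨⟨0, hn⟩⟩
  refine lt_of_lt_of_le ?_ (measure_mono (s := Metric.ball (0 : Eucl n) 1 \ {0}) ?_)
  · rw [measure_sdiff_null (measure_singleton _)]
    exact Metric.measure_ball_pos _ _ one_pos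
  · rintro x ⟨hx, hx0⟩
    have hx0' : x ≠ 0 := hx0
    have h1 : χ x = 1 := hχ.2.1 x (by simpa using (mem_ball_zero_iff.1 hx).le)
    have : 0 < ‖x‖ := norm_pos_iff.2 hx0'
    rw [Function.mem_support, h1, powerFun, if_neg hx0']
    rw [one_mul, one_mul, norm_ne_zero_iff, Complex.ofReal_ne_zero]
    exact (rpow_pos_of_pos this _).ne'

theorem regular_powerFun_notMem_M {s t δ : ℝ} (hn : 0 < n) (hs : 0 ≤ s) (ht : 0 ≤ t) (hδ : 0 < δ)
    (hα : LocallyIntegrable (powerFun n (s + t + δ))) {χ : Test n} (hχ : IsCutoff χ) :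
    regular (powerFun n (s + t + δ)) ∉ M n s t := by
  rintro ⟨-, C, hC, hmul⟩
  -- Adding 1 keeps the constants positive, so that the majorant in the duality estimate is nonzero.
  set S := (sobolevENorm s (toSchwartz χ)).toReal + 1 with hS
  set T := (sobolevENorm t (toSchwartz χ)).toReal + 1 with hT
  have hS0 : 0 < S := by positivity
  have hT0 : 0 < T := by positivity
  have hST : ∀ r : ℝ, sobolevENorm r (toSchwartz χ) ≤
      ENNReal.ofReal ((sobolevENorm r (toSchwartz χ)).toReal + 1) := fun r => by
    refine (ENNReal.ofReal_toReal (sobolevENorm_ne_top r _)).symm.trans_le ?_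
    exact ENNReal.ofReal_le_ofReal (by linarith)
  set c := ‖mulDist χ (regular (powerFun n (s + t + δ))) χ‖ with hc
  have hc0 : 0 < c := norm_pos_iff.2 (mulDist_regular_powerFun_ne_zero hn hα hχ)
  have key : ∀ l : ℝ, 0 < l → l ≤ 1 → c ≤ C * S * T * l ^ δ := by
    intro l hl hl1
    set f := dilate l hl.ne' χ with hf
    have hfs : besselNorm s 2 (regular (f : Eucl n → ℂ)) ≤
        ENNReal.ofReal (l ^ ((n : ℝ) / 2 - s) * S) := by
      rw [ENNReal.ofReal_mul (by positivity)]
      exact (besselNorm_regular_le s f).trans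
        ((sobolevENorm_dilate_le hs hl hl1 χ).trans (by gcongr; exact hST s))
    have hft : sobolevENorm t (toSchwartz f) ≤ ENNReal.ofReal (l ^ ((n : ℝ) / 2 - t) * T) := by
      rw [ENNReal.ofReal_mul (by positivity)]
      exact (sobolevENorm_dilate_le ht hl hl1 χ).trans (by gcongr; exact hST t)
    have hN : ENNReal.ofReal (l ^ ((n : ℝ) / 2 - t) * T) ≠ 0 := by
      simp only [ne_eq, ENNReal.ofReal_eq_zero, not_le]; positivity
    have h1 := enorm_apply_le_besselNorm_mul t (mulDist f (regular (powerFun n (s + t + δ)))) f hN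
      ENNReal.ofReal_ne_top hft
    -- The multiplier bound and duality are applied to the same dilate, as multiplicand and as test
    -- function.
    have h2 := h1.trans (mul_le_mul_left ((hmul f).trans (mul_le_mul_right hfs _)) _)
    rw [mulDist_dilate_regular_powerFun hl hα, ← ofReal_norm, norm_mul, ← hc, Complex.norm_real,
      norm_of_nonneg (by positivity), ← ENNReal.ofReal_mul hC.le,
      ← ENNReal.ofReal_mul (by positivity), ENNReal.ofReal_le_ofReal_iff (by positivity)] at h2
    have e1 : C * (l ^ ((n : ℝ) / 2 - s) * S) * (l ^ ((n : ℝ) / 2 - t) * T) =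
        l ^ ((n : ℝ) - (s + t + δ)) * (C * S * T * l ^ δ) := by
      have : l ^ ((n : ℝ) / 2 - s) * l ^ ((n : ℝ) / 2 - t) =
          l ^ ((n : ℝ) - (s + t + δ)) * l ^ δ := by
        rw [← rpow_add hl, ← rpow_add hl]; congr 1; ring
      calc _ = C * S * T * (l ^ ((n : ℝ) / 2 - s) * l ^ ((n : ℝ) / 2 - t)) := by ring
        _ = _ := by rw [this]; ring
    rw [e1] at h2
    exact le_of_mul_le_mul_left h2 (by positivity)
  have hlim : Tendsto (fun l : ℝ => C * S * T * l ^ δ) (𝓝[>] 0) (𝓝 0) := by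
    have h := ((continuous_rpow_const hδ.le).tendsto 0).const_mul (C * S * T)
    rw [zero_rpow hδ.ne', mul_zero] at h
    exact h.mono_left nhdsWithin_le_nhds
  obtain ⟨l, h1, h2, h3⟩ := ((hlim.eventually (gt_mem_nhds hc0)).and
    (Ioc_mem_nhdsGT (zero_lt_one' ℝ))).exists
  exact absurd (key l h2 h3) (not_le.2 h1)

/-! ### Choice of exponents and conclusion -/

theorem exists_lebesgue_exponent {a b p δ : ℝ} (hn : 0 < n) (hb : 0 ≤ b) (hba : b ≤ a)
    (han : a < (n : ℝ) / 2) (hp : 2 < p) (hδ : 0 < δ) (hpδ : (n : ℝ) / p = a + 2 * δ) :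
    ∃ q : ℝ, 1 ≤ q ∧ (a + b + δ) * q < n ∧
      ((b = 0 ∧ q = p) ∨ (0 < b ∧ 1 / p ≤ 1 / q ∧ 1 / q - 1 / p < b / n)) := by
  have hn' : (0 : ℝ) < n := by exact_mod_cast hn
  have hp0 : 0 < p := by linarith
  rcases hb.eq_or_lt with rfl | hb
  · refine ⟨p, by linarith, ?_, Or.inl ⟨rfl, rfl⟩⟩
    rw [div_eq_iff hp0.ne'] at hpδ
    nlinarith
  -- With `n / q = n / p + c`, the bound `c < b` gives the embedding, and `b - δ < c` gives `n / q =
  -- a + 2δ + c > a + b + δ`. Finally `q ≥ 1`, since `1/p` and `c/n` are both at most `1/2`.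
  · obtain ⟨c, hc1, hc2⟩ := exists_between (max_lt (sub_lt_self b hδ) hb)
    rw [max_lt_iff] at hc1
    have hx : 0 < 1 / p + c / n := by have := hc1.2; positivity
    have hx1 : 1 / p + c / n ≤ 1 := by
      have h1 : 1 / p ≤ 1 / 2 := one_div_le_one_div_of_le two_pos hp.le
      have h2 : c / n ≤ 1 / 2 := by rw [div_le_iff₀ hn']; linarith
      linarith
    refine ⟨1 / (1 / p + c / n), ?_, ?_, Or.inr ⟨hb, ?_, ?_⟩⟩
    · rwa [le_div_iff₀ hx, one_mul]
    · rw [mul_one_div, div_lt_iff₀ hx]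
      have : (n : ℝ) * (1 / p + c / n) = a + 2 * δ + c := by
        rw [← hpδ]; field_simp
      rw [this]; linarith [hc1.1]
    · rw [one_div_one_div]
      have := hc1.2
      exact le_add_of_nonneg_right (by positivity)
    · rw [one_div_one_div, add_sub_cancel_left]
      gcongr

end BesselMult

end

theorem theorem3 (n : ℕ) (s t : ℝ) (hs : 0 ≤ s) (ht : 0 ≤ t)
    (hpos : 0 < max s t) (hlt : max s t < (n : ℝ) / 2)
    (ε : ℝ) (hε : 0 < ε) (hε' : ε < (n : ℝ) / max s t - 2) :
    (∃ δ : ℝ, 0 < δ ∧ δ < (n : ℝ) / 2 - max s t ∧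
      MeasureTheory.LocallyIntegrable (BesselMult.powerFun n (s + t + δ)) ∧
      ∀ η : BesselMult.Test n, BesselMult.IsCutoff η →
        BesselMult.regular (BesselMult.powerFun n (s + t + δ)) ∈
          BesselMult.besselUnif (-(min s t)) (ENNReal.ofReal ((n : ℝ) / max s t - ε)) η \
            BesselMult.M n s t) ∧
    ∀ η : BesselMult.Test n, BesselMult.IsCutoff η →
      ¬ BesselMult.besselUnif (-(min s t)) (ENNReal.ofReal ((n : ℝ) / max s t - ε)) η ⊆
          BesselMult.M n s t := by
  have main : ∃ δ : ℝ, 0 < δ ∧ δ < (n : ℝ) / 2 - max s t ∧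
      MeasureTheory.LocallyIntegrable (BesselMult.powerFun n (s + t + δ)) ∧
      ∀ η : BesselMult.Test n, BesselMult.IsCutoff η →
        BesselMult.regular (BesselMult.powerFun n (s + t + δ)) ∈
          BesselMult.besselUnif (-(min s t)) (ENNReal.ofReal ((n : ℝ) / max s t - ε)) η \
            BesselMult.M n s t := by
    have hn' : (0 : ℝ) < n := by linarith
    have hn : 0 < n := by exact_mod_cast hn'
    have hst : s + t = max s t + min s t := (max_add_min s t).symm
    have hmin : 0 ≤ min s t := le_min hs ht
    have hmm : min s t ≤ max s t := min_le_max
    set a := max s t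
    set b := min s t
    set p := (n : ℝ) / a - ε with hp
    have hp2 : 2 < p := by linarith
    have hp0 : 0 < p := by linarith
    have hpa : a < n / p := by
      have h : p < n / a := by linarith
      rw [lt_div_iff₀ hpos] at h
      rw [lt_div_iff₀ hp0]
      linarith
    have hpn : (n : ℝ) / p < n / 2 := by gcongr
    -- Half the gap, so that `n / p = a + 2δ`. As `p > 2`, also `a + 2δ < n / 2`, which bounds `δ`
    -- and, with `b ≤ a < n / 2`, yields `s + t + δ < n`.
    obtain ⟨δ, hδ⟩ : ∃ δ, δ = (n / p - a) / 2 := ⟨_, rfl⟩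
    have hδ0 : 0 < δ := by linarith
    obtain ⟨q, hq, hαq, h⟩ := BesselMult.exists_lebesgue_exponent hn hmin hmm hlt hp2 hδ0
      (by linarith)
    have hαn : s + t + δ < n := by linarith
    have hloc := BesselMult.locallyIntegrable_powerFun hn hαn
    refine ⟨δ, hδ0, by linarith, hloc, fun η hη => ⟨?_, ?_⟩⟩
    · exact BesselMult.regular_powerFun_mem_besselUnif hn (by positivity) hαn (by linarith) hq
        (by rwa [hst]) h hη
    · exact BesselMult.regular_powerFun_notMem_M hn hs ht hδ0 hloc hη
  refine ⟨main, fun η hη hsub => ?_⟩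
  obtain ⟨δ, -, -, -, h⟩ := main
  exact (h η hη).2 (hsub (h η hη).1)
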